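/- Let $S=\Bbbk[x_1,\dots,x_n]$ be a polynomial ring over a field $\Bbbk$, let $I\subseteq S$ be a monomial ideal, and let $\mathcal G(I)$ be its set of minimal monomial generators. For $F\subseteq\mathcal G(I)$ let $\mathbf m_F$ be the least common multiple of the elements of $F$ (with $\mathbf m_\emptyset=1$). A monomial $u=x^{a}$ properly divides $v=x^{b}$ if $u\mid v$ and, for every $i$, $a_i<b_i$ whenever $b_i\neq 0$, and $a_i=b_i$ whenever $b_i=0$. Put $$\mathfrak{Bu}(I)=\{F\subseteq\mathcal G(I) : \text{no } u\in\mathcal G(I) \text{ properly divides } \mathbf m_F\},$$ $$\mathfrak{Sc}(I)=\{F\subseteq\mathcal G(I) : \text{for all } G\subseteq\mathcal G(I),\ \mathbf m_F=\mathbf m_G \Rightarrow F=G\};$$ these are simplicial complexes, the Buchberger complex and the Scarf complex of $I$. For a simplicial complex $\Delta$ on (a subset of) $\mathcal G(I)$ let $\mathcal F_\Delta$ be the complex of free $S$-modules whose term in homological degree $i\ge 0$ has basis $\{e_F : F\in\Delta,\ |F|=i+1\}$, with differential $$d(e_F)=\sum_{v\in F}\operatorname{sgn}(v,F)\,\frac{\mathbf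 m_F}{\mathbf m_{F\setminus\{v\}}}\,e_{F\setminus\{v\}}$$ (the usual simplicial signs with respect to a fixed total order on $\mathcal G(I)$), and with augmentation $\mathcal F_{\Delta,0}\to I$, $e_{\{v\}}\mapsto v$. One says that $\mathcal F_\Delta$ is a minimal free resolution of $I$ if $\cdots\to\mathcal F_{\Delta,1}\to\mathcal F_{\Delta,0}\to I\to 0$ is exact and $d(\mathcal F_{\Delta,i+1})\subseteq(x_1,\dots,x_n)\mathcal F_{\Delta,i}$ for all $i\ge 0$. If $\mathcal F_{\mathfrak{Bu}(I)}$ (the Buchberger resolution) is a minimal free resolution of $I$, then $\mathcal F_{\mathfrak{Sc}(I)}$ (the algebraic Scarf complex) is a minimal free resolution of $I$. Moreover, in that case $\mathfrak{Sc}(I)=\mathfrak{Bu}(I)$, and hence the complexes $\mathcal F_{\mathfrak{Sc}(I)}$ and $\mathcal F_{\mathfrak{Bu}(I)}$ coincide. -/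

import Mathlib

open CategoryTheory

namespace MonomialResolution

universe u

variable {k : Type u} [Field k] {n : ℕ}

/-- A monomial ideal of `k[x_1, …, x_n]`: an ideal generated by monomials. A monomial is
represented by its exponent vector. -/
def IsMonomialIdeal (I : Ideal (MvPolynomial (Fin n) k)) : Prop :=
  ∃ A : Set (Fin n →₀ ℕ), I = Ideal.span ((fun a => MvPolynomial.monomial a (1 : k)) '' A)

/-- (Exponent vectors of) the minimal monomial generators of `I`: the monomials of `I` that are
minimal with respect to divisibility. -/
def minGens (I : Ideal (MvPolynomial (Fin n) k)) : Set (Fin n →₀ ℕ) :=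
  {a | Minimal (fun b : Fin n →₀ ℕ => MvPolynomial.monomial b (1 : k) ∈ I) a}

theorem monomial_mem_of_mem_minGens {I : Ideal (MvPolynomial (Fin n) k)} {a : Fin n →₀ ℕ}
    (h : a ∈ minGens I) : MvPolynomial.monomial a (1 : k) ∈ I :=
  h.1

/-- `u` properly divides `v`: `u` divides `v`, and for every `i` one has `u_i < v_i` if `v_i ≠ 0`
and `u_i = v_i` if `v_i = 0`. -/
def ProperlyDivides (u v : Fin n →₀ ℕ) : Prop :=
  u ≤ v ∧ ∀ i, (v i ≠ 0 → u i < v i) ∧ (v i = 0 → u i = v i)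

theorem ProperlyDivides.trans_le {u v w : Fin n →₀ ℕ} (h : ProperlyDivides u v) (hvw : v ≤ w) :
    ProperlyDivides u w := by
  refine ⟨h.1.trans hvw, fun i => ⟨fun hw => ?_, fun hw => ?_⟩⟩
  · have h1 := hvw i
    by_cases hv : v i = 0
    · have := (h.2 i).2 hv
      omega
    · have := (h.2 i).1 hv
      omega
  · have h1 := hvw i
    have h2 := h.1 i
    omega

section Faces

variable {V : Set (Fin n →₀ ℕ)}

/-- The label of a face `F`: the least common multiple of its vertices (which is `1`, with
exponent vector `0`, for the empty face). -/
noncomputable def faceLcm (F : Finset V) : Fin n →₀ ℕ :=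
  F.sup (fun v => (v : Fin n →₀ ℕ))

theorem faceLcm_mono {F G : Finset V} (h : F ⊆ G) : faceLcm F ≤ faceLcm G :=
  Finset.sup_mono h

theorem le_faceLcm {F : Finset V} {v : V} (h : v ∈ F) : (v : Fin n →₀ ℕ) ≤ faceLcm F :=
  Finset.le_sup (f := fun v : V => (v : Fin n →₀ ℕ)) h

open Classical in
theorem faceLcm_union (F G : Finset V) : faceLcm (F ∪ G) = faceLcm F ⊔ faceLcm G :=
  Finset.sup_union

/-- The sign of `v` in the oriented simplex `F`: `(-1) ^ j`, where `v` is the `j`-th vertex of `F`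
(counted from `0`), the vertices being ordered lexicographically. -/
noncomputable def sign (F : Finset V) (v : V) : ℤ :=
  (-1) ^ (F.filter (fun u : V => toLex (u : Fin n →₀ ℕ) < toLex (v : Fin n →₀ ℕ))).card

end Faces

/-- The Buchberger complex of `I`. A (finite abstract) simplicial complex is a
collection of finite vertex sets closed under taking subsets, i.e. a lower set of finsets; the
empty face is allowed. -/
def buchbergerComplex (I : Ideal (MvPolynomial (Fin n) k)) : LowerSet (Finset (minGens I)) where
  carrier := {F | ∀ u ∈ minGens I, ¬ ProperlyDivides u (faceLcm F)}
  lower' := fun _ _ hGF hF u hu h => hF u hu (h.trans_le (faceLcm_mono hGF))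

/-- The Scarf complex of `I`: the sets of minimal generators whose label is unique. -/
def scarfComplex (I : Ideal (MvPolynomial (Fin n) k)) : LowerSet (Finset (minGens I)) where
  carrier := {F | ∀ G : Finset (minGens I), faceLcm F = faceLcm G → F = G}
  lower' := by
    classical
    intro F G hGF hF H hH
    have hGF : G ⊆ F := hGF
    have key : F = H ∪ F := by
      apply hF
      rw [faceLcm_union, ← hH, sup_eq_right.2 (faceLcm_mono hGF)]
    have hHF : H ⊆ F := Finset.union_eq_right.1 key.symm
    have key2 : F = H ∪ (F \ G) := by
      apply hF
      rw [faceLcm_union, ← hH, ← faceLcm_union, Finset.union_sdiff_of_subset hGF]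
    have hGH : G ⊆ H := by
      intro v hv
      have h1 : v ∈ H ∪ (F \ G) := by rw [← key2]; exact hGF hv
      rcases Finset.mem_union.1 h1 with h | h
      · exact h
      · exact absurd hv (Finset.mem_sdiff.1 h).2
    refine Finset.Subset.antisymm hGH fun v hv => ?_
    by_contra hvG
    have hle : (v : Fin n →₀ ℕ) ≤ faceLcm (F.erase v) := by
      calc (v : Fin n →₀ ℕ) ≤ faceLcm H := le_faceLcm hv
        _ = faceLcm G := hH.symm
        _ ≤ faceLcm (F.erase v) := faceLcm_mono fun w hw =>
          Finset.mem_erase.2 ⟨fun h => hvG (h ▸ hw), hGF hw⟩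
    have h2 : F = F.erase v := by
      apply hF
      refine le_antisymm ?_ (faceLcm_mono (Finset.erase_subset _ _))
      refine Finset.sup_le fun w hw => ?_
      by_cases hwv : w = v
      · subst hwv; exact hle
      · exact le_faceLcm (Finset.mem_erase.2 ⟨hwv, hw⟩)
    exact Finset.notMem_erase v F (h2 ▸ hHF hv)

section Cellular

variable {I : Ideal (MvPolynomial (Fin n) k)}

/-- The faces of `Δ` with `p` vertices (that is, of dimension `p - 1`). -/
abbrev Face (Δ : LowerSet (Finset (minGens I))) (p : ℕ) : Type :=
  {F : Finset (minGens I) // F ∈ Δ ∧ F.card = p}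

/-- The free `S`-module with basis the faces of `Δ` with `p` vertices; the basis element of `F`
has multidegree `faceLcm F`. -/
abbrev Chains (Δ : LowerSet (Finset (minGens I))) (p : ℕ) : Type u :=
  Face Δ p →₀ MvPolynomial (Fin n) k

open Classical in
/-- The face `F ∖ {v}` of a face `F`. -/
noncomputable def Face.erase {Δ : LowerSet (Finset (minGens I))} {p : ℕ} (F : Face Δ (p + 1))
    (v : {v // v ∈ F.1}) : Face Δ p :=
  ⟨F.1.erase v.1, Δ.lower (Finset.erase_subset v.1 F.1) F.2.1, by
    rw [Finset.card_erase_of_mem v.2, F.2.2, Nat.add_sub_cancel]⟩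

open Classical in
/-- The coefficient of `F ∖ {v}` in the homogenized boundary of `F`: the sign of `v` in `F` times
the monomial `faceLcm F / faceLcm (F ∖ {v})`. -/
noncomputable def coeff (F : Finset (minGens I)) (v : minGens I) : MvPolynomial (Fin n) k :=
  MvPolynomial.monomial (faceLcm F - faceLcm (F.erase v)) ((sign F v : ℤ) : k)

/-- The simplicial boundary map, homogenized with respect to the multigrading. -/
noncomputable def boundary (Δ : LowerSet (Finset (minGens I))) (p : ℕ) :
    Chains Δ (p + 1) →ₗ[MvPolynomial (Fin n) k] Chains Δ p :=
  Finsupp.linearCombination (MvPolynomial (Fin n) k)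
    (fun F : Face Δ (p + 1) => ∑ v ∈ F.1.attach, Finsupp.single (F.erase v) (coeff F.1 v.1))

open Classical in
theorem sign_swap {V : Set (Fin n →₀ ℕ)} (F : Finset V) {v w : V} (hv : v ∈ F) (hw : w ∈ F)
    (hvw : v ≠ w) : sign F v * sign (F.erase v) w = - (sign F w * sign (F.erase w) v) := by
  wlog h : toLex (v : Fin n →₀ ℕ) < toLex (w : Fin n →₀ ℕ) generalizing v w
  · have h' : toLex (w : Fin n →₀ ℕ) < toLex (v : Fin n →₀ ℕ) := by
      refine lt_of_le_of_ne (not_lt.1 h) fun e => hvw ?_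
      exact (Subtype.ext (toLex.injective e)).symm
    rw [this hw hv hvw.symm h', neg_neg]
  · have h1 : sign (F.erase w) v = sign F v := by
      unfold sign
      rw [Finset.filter_erase, Finset.erase_eq_of_notMem]
      simp only [Finset.mem_filter, not_and, not_lt]
      exact fun _ => h.le
    have h2 : sign F w = - sign (F.erase v) w := by
      unfold sign
      have hm : v ∈ F.filter (fun u : V => toLex (u : Fin n →₀ ℕ) < toLex (w : Fin n →₀ ℕ)) :=
        Finset.mem_filter.2 ⟨hv, h⟩
      rw [Finset.filter_erase, ← Finset.card_erase_add_one hm, pow_succ]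
      ring
    rw [h1, h2]
    ring

open Classical in
theorem coeff_swap (F : Finset (minGens I)) {v w : minGens I} (hv : v ∈ F) (hw : w ∈ F)
    (hvw : v ≠ w) :
    coeff F v * coeff (F.erase v) w + coeff F w * coeff (F.erase w) v = 0 := by
  unfold coeff
  rw [MvPolynomial.monomial_mul, MvPolynomial.monomial_mul,
    tsub_add_tsub_cancel (faceLcm_mono (Finset.erase_subset _ _)) (faceLcm_mono (Finset.erase_subset _ _)),
    tsub_add_tsub_cancel (faceLcm_mono (Finset.erase_subset _ _)) (faceLcm_mono (Finset.erase_subset _ _)),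
    Finset.erase_right_comm, ← map_add, ← Int.cast_mul, ← Int.cast_mul, sign_swap F hv hw hvw]
  simp

theorem boundary_single (Δ : LowerSet (Finset (minGens I))) (p : ℕ) (F : Face Δ (p + 1))
    (c : MvPolynomial (Fin n) k) :
    boundary Δ p (Finsupp.single F c) =
      c • ∑ v ∈ F.1.attach, Finsupp.single (F.erase v) (coeff F.1 v.1) := by
  rw [boundary, Finsupp.linearCombination_single]

theorem boundary_comp_boundary (Δ : LowerSet (Finset (minGens I))) (p : ℕ) :
    boundary Δ p ∘ₗ boundary Δ (p + 1) = 0 := by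
  classical
  refine Finsupp.lhom_ext fun F c => ?_
  rw [LinearMap.comp_apply, boundary_single, map_smul, map_sum, LinearMap.zero_apply]
  suffices h : ∑ v ∈ F.1.attach,
      boundary Δ p (Finsupp.single (F.erase v) (coeff F.1 v.1)) = 0 by
    rw [h, smul_zero]
  simp only [boundary_single]
  apply Finsupp.mapDomain_injective (f := (Subtype.val : Face Δ p → Finset (minGens I)))
    Subtype.val_injective
  rw [Finsupp.mapDomain_zero, Finsupp.mapDomain_finsetSum]
  simp only [Finset.smul_sum, Finsupp.smul_single, Finsupp.mapDomain_finsetSum,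
    Finsupp.mapDomain_single, smul_eq_mul, Face.erase]
  have step : ∀ v : minGens I,
      ∑ w ∈ (F.1.erase v).attach, Finsupp.single ((F.1.erase v).erase w.1)
        (coeff F.1 v * coeff (F.1.erase v) w.1) =
      ∑ w ∈ F.1.erase v, Finsupp.single ((F.1.erase v).erase w)
        (coeff F.1 v * coeff (F.1.erase v) w) := fun v =>
    Finset.sum_attach (F.1.erase v) (fun w => Finsupp.single ((F.1.erase v).erase w)
        (coeff F.1 v * coeff (F.1.erase v) w))
  simp only [step]
  rw [Finset.sum_attach F.1 (fun v => ∑ w ∈ F.1.erase v, Finsupp.single ((F.1.erase v).erase w)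
        (coeff F.1 v * coeff (F.1.erase v) w)), Finset.sum_sigma']
  refine Finset.sum_involution (fun x _ => ⟨x.2, x.1⟩) ?_ ?_ ?_ ?_
  · rintro ⟨v, w⟩ h
    simp only [Finset.mem_sigma, Finset.mem_erase] at h
    dsimp only
    rw [Finset.erase_right_comm (a := w) (b := v), ← Finsupp.single_add,
      coeff_swap F.1 h.1 h.2.2 (Ne.symm h.2.1), Finsupp.single_zero]
  · rintro ⟨v, w⟩ h _ e
    simp only [Finset.mem_sigma, Finset.mem_erase] at h
    exact h.2.1 (congrArg Sigma.fst e)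
  · rintro ⟨v, w⟩ h
    simp only [Finset.mem_sigma, Finset.mem_erase] at h ⊢
    exact ⟨h.2.2, Ne.symm h.2.1, h.1⟩
  · rintro ⟨v, w⟩ h
    rfl

/-- The chain complex `F_Δ` of free `S`-modules supported on the labeled complex `Δ`: the module in
homological degree `i` has as basis the `i`-dimensional faces. -/
noncomputable def cellularComplex (Δ : LowerSet (Finset (minGens I))) :
    ChainComplex (ModuleCat.{u} (MvPolynomial (Fin n) k)) ℕ :=
  ChainComplex.of (fun i => ModuleCat.of (MvPolynomial (Fin n) k) (Chains Δ (i + 1)))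
    (fun i => ModuleCat.ofHom (boundary Δ (i + 1)))
    (fun i => by
      rw [← ModuleCat.ofHom_comp, boundary_comp_boundary]
      rfl)

theorem cellularComplex_d (Δ : LowerSet (Finset (minGens I))) (i : ℕ) :
    (cellularComplex Δ).d (i + 1) i = ModuleCat.ofHom (boundary Δ (i + 1)) := by
  unfold cellularComplex
  exact ChainComplex.of_d
    (fun i => ModuleCat.of (MvPolynomial (Fin n) k) (Chains Δ (i + 1)))
    (fun i => ModuleCat.ofHom (boundary Δ (i + 1))) i

/-- The monomial of a vertex label, as an element of `I`. -/
noncomputable def faceMonomial {Δ : LowerSet (Finset (minGens I))} (F : Face Δ 1) : I :=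
  ⟨MvPolynomial.monomial (faceLcm F.1) 1, by
    obtain ⟨v, hv⟩ := Finset.card_eq_one.1 F.2.2
    rw [hv, faceLcm, Finset.sup_singleton]
    exact monomial_mem_of_mem_minGens v.2⟩

/-- The augmentation `F_Δ → I` in homological degree `0`, sending the basis element of a vertex
to the monomial which labels it. -/
noncomputable def augmentation (Δ : LowerSet (Finset (minGens I))) :
    (cellularComplex Δ).X 0 ⟶ ModuleCat.of (MvPolynomial (Fin n) k) I :=
  ModuleCat.ofHom (X := Chains Δ 1)
    (Finsupp.linearCombination (MvPolynomial (Fin n) k) (faceMonomial (Δ := Δ)))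

end Cellular

/-- The complex `C` of `R`-modules, with the augmentation `ε : C_0 → M`, is a minimal free
resolution of `M` with respect to the ideal `𝔪`: all `C_i` are free,
`⋯ → C_1 → C_0 → M → 0` is exact, and `d (C_{i+1}) ⊆ 𝔪 C_i` for all `i`. -/
structure IsMinimalFreeResolution {R : Type u} [CommRing R] (𝔪 : Ideal R)
    (C : ChainComplex (ModuleCat.{u} R) ℕ) {M : ModuleCat.{u} R} (ε : C.X 0 ⟶ M) : Prop where
  free : ∀ i, Module.Free R (C.X i)
  surjective : Function.Surjective ε.hom
  exact_zero : Function.Exact (C.d 1 0).hom ε.hom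
  exact_succ : ∀ i, Function.Exact (C.d (i + 2) (i + 1)).hom (C.d (i + 1) i).hom
  minimal : ∀ i, LinearMap.range (C.d (i + 1) i).hom ≤ 𝔪 • (⊤ : Submodule R (C.X i))

/-- The graded maximal ideal `(x_1, …, x_n)`. -/
noncomputable def irrelevantIdeal (k : Type u) [Field k] (n : ℕ) :
    Ideal (MvPolynomial (Fin n) k) :=
  Ideal.span (Set.range MvPolynomial.X)

/-- The complex supported on the labeled simplicial complex `Δ` on the minimal generators of `I`
is a minimal free resolution of `I`. -/
def SupportsMinimalFreeResolution {I : Ideal (MvPolynomial (Fin n) k)}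
    (Δ : LowerSet (Finset (minGens I))) : Prop :=
  IsMinimalFreeResolution (irrelevantIdeal k n) (cellularComplex Δ) (augmentation Δ)

end MonomialResolution

/-!
The labels of the faces decide everything. If a generator `u` properly divides the label of `F`,
then adding `u` to `F` or removing it from `F` does not change the label, so `F` is not a Scarf
face; hence the Scarf complex is contained in the Buchberger complex, for every `I`
(`scarfComplex_le_buchbergerComplex`).

Conversely, if the complex supported on `Δ` is minimal, then removing a vertex from a face of `Δ`
with at least two vertices changes its label, since otherwise the boundary would have an entry
`±1` (`faceLcm_erase_ne_of_minimal`). Whether `F` lies in the Buchberger complex depends on its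
label only, so if `F` is a Buchberger face and `G` has the same label, then `F ∪ G` is a Buchberger
face with that label too, and so are all sets between `F` and `F ∪ G`. Minimality therefore forces
`F ∪ G = F`, and symmetrically `F ∪ G = G` (`buchbergerComplex_le_scarfComplex`). The two complexes
coincide, and so do the algebraic complexes supported on them.
-/

namespace MonomialResolution

universe u

section Labels

variable {n : ℕ} {V : Set (Fin n →₀ ℕ)}

open Classical in
/-- A vertex that properly divides the label attains none of the nonzero exponents of the label,
so it can be removed from the face without changing the label. -/
theorem faceLcm_erase_of_properlyDivides {F : Finset V} {v : V}
    (h : ProperlyDivides (v : Fin n →₀ ℕ) (faceLcm F)) : faceLcm (F.erase v) = faceLcm F := by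
  refine le_antisymm (faceLcm_mono (Finset.erase_subset v F)) fun i => ?_
  have hsup : faceLcm F ≤ (v : Fin n →₀ ℕ) ⊔ faceLcm (F.erase v) := by
    refine Finset.sup_le fun w hw => ?_
    by_cases hwv : w = v
    · exact hwv ▸ le_sup_left
    · exact (le_faceLcm (Finset.mem_erase.2 ⟨hwv, hw⟩)).trans le_sup_right
  have hi := hsup i
  rw [Finsupp.sup_apply, le_sup_iff] at hi
  have hlt := (h.2 i).1
  omega

open Classical in
theorem faceLcm_insert_of_le {F : Finset V} {v : V} (h : (v : Fin n →₀ ℕ) ≤ faceLcm F) :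
    faceLcm (insert v F) = faceLcm F := by
  unfold faceLcm at h ⊢
  rw [Finset.sup_insert, sup_eq_right.2 h]

end Labels

variable {k : Type u} [Field k] {n : ℕ} {I : Ideal (MvPolynomial (Fin n) k)}

theorem scarfComplex_le_buchbergerComplex (I : Ideal (MvPolynomial (Fin n) k)) :
    scarfComplex I ≤ buchbergerComplex I := by
  classical
  intro F hF u hu h
  have hF : ∀ G : Finset (minGens I), faceLcm F = faceLcm G → F = G := hF
  have hinsert : F = insert ⟨u, hu⟩ F := hF _ (faceLcm_insert_of_le (v := ⟨u, hu⟩) h.1).symm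
  have herase : F = F.erase ⟨u, hu⟩ :=
    hF _ (faceLcm_erase_of_properlyDivides (v := ⟨u, hu⟩) h).symm
  have hmem : (⟨u, hu⟩ : minGens I) ∈ F := hinsert ▸ Finset.mem_insert_self _ _
  exact Finset.notMem_erase _ F (herase ▸ hmem)

theorem constantCoeff_eq_zero_of_mem_irrelevantIdeal {f : MvPolynomial (Fin n) k}
    (hf : f ∈ irrelevantIdeal k n) : MvPolynomial.constantCoeff f = 0 := by
  have hle : irrelevantIdeal k n ≤ RingHom.ker (MvPolynomial.constantCoeff (σ := Fin n) (R := k)) :=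
    Ideal.span_le.2 (by rintro _ ⟨i, rfl⟩; simp)
  exact hle hf

theorem boundary_single_apply_erase {Δ : LowerSet (Finset (minGens I))} {p : ℕ}
    (F : Face Δ (p + 1)) (v : {v // v ∈ F.1}) :
    boundary Δ p (Finsupp.single F 1) (F.erase v) = coeff F.1 v.1 := by
  classical
  rw [boundary_single, one_smul, Finsupp.finsetSum_apply,
    Finset.sum_eq_single_of_mem v (Finset.mem_attach _ _), Finsupp.single_eq_same]
  intro w _ hwv
  refine Finsupp.single_eq_of_ne fun h => hwv ?_
  exact Subtype.ext (Finset.erase_injOn F.1 w.2 v.2 (congrArg Subtype.val h).symm)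

open Classical in
/-- In a minimal complex no boundary entry is a unit, so the label of a face with at least two
vertices differs from the labels of its facets. -/
theorem faceLcm_erase_ne_of_minimal {Δ : LowerSet (Finset (minGens I))}
    (hΔ : SupportsMinimalFreeResolution Δ) {F : Finset (minGens I)} (hF : F ∈ Δ)
    (hcard : 2 ≤ F.card) {v : minGens I} (hv : v ∈ F) : faceLcm (F.erase v) ≠ faceLcm F := by
  intro heq
  obtain ⟨i, hi⟩ := Nat.exists_eq_add_of_le' hcard
  let F' : Face Δ (i + 1 + 1) := ⟨F, hF, hi⟩
  have hmin := hΔ.minimal i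
  rw [cellularComplex_d] at hmin
  have hmem : boundary Δ (i + 1) (Finsupp.single F' 1) ∈
      irrelevantIdeal k n • (⊤ : Submodule (MvPolynomial (Fin n) k) (Chains Δ (i + 1))) :=
    hmin ⟨Finsupp.single F' 1, rfl⟩
  have hcoeff : coeff F v ∈ irrelevantIdeal k n := by
    have h := Submodule.mem_map_of_mem (f := Finsupp.lapply (R := MvPolynomial (Fin n) k)
      (F'.erase ⟨v, hv⟩)) hmem
    rw [Submodule.map_smul''] at h
    replace h := Submodule.smul_mono le_rfl le_top h
    rw [Finsupp.lapply_apply, boundary_single_apply_erase, smul_eq_mul, Ideal.mul_top] at h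
    exact h
  have hzero := constantCoeff_eq_zero_of_mem_irrelevantIdeal hcoeff
  rw [coeff, heq, tsub_self, MvPolynomial.constantCoeff_monomial, if_pos rfl, sign] at hzero
  simp at hzero

/-- In a minimal Buchberger complex, a Buchberger face has no proper superset with the same
label. -/
theorem eq_of_subset_of_faceLcm_eq
    (hBu : SupportsMinimalFreeResolution (buchbergerComplex I)) {F H : Finset (minGens I)}
    (hH : H ∈ buchbergerComplex I) (hFH : F ⊆ H) (heq : faceLcm F = faceLcm H) : F = H := by
  classical
  refine hFH.antisymm fun v hv => ?_
  by_contra hvF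
  have herase : faceLcm (H.erase v) = faceLcm H :=
    le_antisymm (faceLcm_mono (Finset.erase_subset v H))
      (heq ▸ faceLcm_mono (Finset.subset_erase.2 ⟨hFH, hvF⟩))
  by_cases hcard : 2 ≤ H.card
  · exact faceLcm_erase_ne_of_minimal hBu hH hcard hv herase
  · -- Here `H = {v}` has label `1`, so `v = 1`, and `1` properly divides itself.
    have hempty : H.erase v = ∅ := by
      rw [← Finset.card_eq_zero, Finset.card_erase_of_mem hv]
      omega
    have hlabel : faceLcm H = 0 := by
      rw [← herase, hempty]
      rfl
    have hv0 : (v : Fin n →₀ ℕ) = 0 := le_antisymm (hlabel ▸ le_faceLcm hv) zero_le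
    refine hH v v.2 ?_
    rw [hlabel, hv0]
    exact ⟨le_rfl, fun i => ⟨fun h => absurd rfl h, fun _ => rfl⟩⟩

theorem buchbergerComplex_le_scarfComplex
    (hBu : SupportsMinimalFreeResolution (buchbergerComplex I)) :
    buchbergerComplex I ≤ scarfComplex I := by
  classical
  intro F hF G hFG
  have hlabel : faceLcm F = faceLcm (F ∪ G) := by rw [faceLcm_union, ← hFG, sup_idem]
  have hunion : F ∪ G ∈ buchbergerComplex I := by
    intro u hu
    rw [← hlabel]
    exact hF u hu
  rw [eq_of_subset_of_faceLcm_eq hBu hunion Finset.subset_union_right (hFG.symm.trans hlabel)]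
  exact eq_of_subset_of_faceLcm_eq hBu hunion Finset.subset_union_left hlabel

end MonomialResolution

theorem mainTheorem6 {k : Type*} [Field k] {n : ℕ} (I : Ideal (MvPolynomial (Fin n) k))
    (hI : MonomialResolution.IsMonomialIdeal I)
    (hBu : MonomialResolution.SupportsMinimalFreeResolution
      (MonomialResolution.buchbergerComplex I)) :
    MonomialResolution.SupportsMinimalFreeResolution (MonomialResolution.scarfComplex I) ∧
      MonomialResolution.scarfComplex I = MonomialResolution.buchbergerComplex I ∧
      MonomialResolution.cellularComplex (MonomialResolution.scarfComplex I) =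
        MonomialResolution.cellularComplex (MonomialResolution.buchbergerComplex I) := by
  have heq : MonomialResolution.scarfComplex I = MonomialResolution.buchbergerComplex I :=
    (MonomialResolution.scarfComplex_le_buchbergerComplex I).antisymm
      (MonomialResolution.buchbergerComplex_le_scarfComplex hBu)
  rw [heq]
  exact ⟨hBu, rfl, rfl⟩
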